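/- Let $M$ be a simply connected smooth manifold and let $n \ge 0$ be an integer. Let $\mathcal{G}_n$ be the constant sheaf on $M$ with stalk the group $GL(n,\mathbb{R})$, that is, the sheaf of locally constant $GL(n,\mathbb{R})$-valued functions. For an open cover $\mathcal{U}=\{U_\alpha\}_{\alpha\in A}$ of $M$, let $\check{H}^1(\mathcal{U},\mathcal{G}_n)$ be the pointed set of $1$-cocycles, i.e. families $a_{\alpha\beta}\in\mathcal{G}_n(U_\alpha\cap U_\beta)$ with $a_{\alpha\gamma}^{-1}a_{\alpha\beta}a_{\beta\gamma}=1$ on $U_\alpha\cap U_\beta\cap U_\gamma$, modulo the equivalence relation $a\sim a'$ if and only if there are $b_\alpha\in\mathcal{G}_n(U_\alpha)$ with $a'_{\alpha\beta}=b_\alpha^{-1}a_{\alpha\beta}b_\beta$ on $U_\alpha\cap U_\beta$ for all $\alpha,\beta$; the distinguished element is the class of the identity cocycle. Let $H^1(M,\mathcal{G}_n)=\varinjlim_{\mathcal{U}}\check{H}^1(\mathcal{U},\mathcal{G}_n)$, the direct limit over all open covers of $M$ ordered by refinement, with distinguished element $1$. Then $$H^1(M,\mathcal{G}_n)=\{1\}.$$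 -/

import Mathlib

noncomputable section

namespace CechH1

open CategoryTheory TopologicalSpace Opposite

universe u

/-- The constant sheaf with stalk the group `A` on the space `X`, as a presheaf of groups: its
sections over an open set `U` are the locally constant functions `U → A`, and its restriction maps
are restriction of functions. -/
def constantSheaf (X : Type u) [TopologicalSpace X] (A : Type) [Group A] :
    (Opens X)ᵒᵖ ⥤ GrpCat.{u} where
  obj U := GrpCat.of (LocallyConstant (unop U : Opens X) A)
  map {U V} i := GrpCat.ofHom
    (LocallyConstant.comapMonoidHom ⟨Set.inclusion i.unop.le, continuous_inclusion i.unop.le⟩)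

/-- An open cover of `X`, indexed by an arbitrary type. -/
structure OpenCover (X : Type u) [TopologicalSpace X] where
  /-- the index type -/
  ι : Type u
  /-- the members of the cover -/
  U : ι → Opens X
  /-- the members cover `X` -/
  iSup_eq_top : ⨆ i, U i = ⊤

namespace OpenCover

variable {X : Type u} [TopologicalSpace X]

/-- `𝒰 ≤ 𝒱` means that `𝒱` refines `𝒰`. -/
instance : Preorder (OpenCover X) where
  le 𝒰 𝒱 := ∃ ρ : 𝒱.ι → 𝒰.ι, ∀ j, 𝒱.U j ≤ 𝒰.U (ρ j)
  le_refl _ := ⟨id, fun _ => le_rfl⟩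
  le_trans := fun _ _ _ ⟨ρ, hρ⟩ ⟨σ, hσ⟩ => ⟨ρ ∘ σ, fun j => (hσ j).trans (hρ (σ j))⟩

/-- The common refinement of two open covers by pairwise intersections. -/
def inter (𝒰 𝒱 : OpenCover X) : OpenCover X where
  ι := 𝒰.ι × 𝒱.ι
  U p := 𝒰.U p.1 ⊓ 𝒱.U p.2
  iSup_eq_top := by
    rw [iSup_prod]
    simp_rw [← inf_iSup_eq, 𝒱.iSup_eq_top, inf_top_eq, 𝒰.iSup_eq_top]

instance : IsDirectedOrder (OpenCover X) where
  directed 𝒰 𝒱 := ⟨inter 𝒰 𝒱, ⟨Prod.fst, fun _ => inf_le_left⟩, ⟨Prod.snd, fun _ => inf_le_right⟩⟩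

instance : Nonempty (OpenCover X) := ⟨⟨PUnit, fun _ => ⊤, by simp⟩⟩

end OpenCover

section Restriction

variable {X : Type u} [TopologicalSpace X] (G : (Opens X)ᵒᵖ ⥤ GrpCat.{u})

/-- The first cohomology set `Ȟ¹(𝒰, G)` of an open cover: the 1-cocycles of `𝒰` with values in `G`
modulo the relation of being cohomologous. -/
abbrev coverH1 (𝒰 : OpenCover X) : Type u := PresheafOfGroups.H1 G 𝒰.U

variable {G} {𝒰 𝒱 𝒲 : OpenCover X}

/-- Restriction of a 1-cocycle along a refinement map `ρ` :
`t̂ α β` is the restriction of `t (ρ α) (ρ β)`. -/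
def restrictCocycle (ρ : 𝒱.ι → 𝒰.ι) (h : ∀ j, 𝒱.U j ≤ 𝒰.U (ρ j))
    (t : PresheafOfGroups.OneCocycle G 𝒰.U) : PresheafOfGroups.OneCocycle G 𝒱.U where
  ev i j _ a b := t.ev (ρ i) (ρ j) (a ≫ homOfLE (h i)) (b ≫ homOfLE (h j))
  ev_precomp i j _ _ φ a b := by simp
  ev_trans i j k _ a b c := t.ev_trans _ _ _ _ _ _

/-- Restrictions of cohomologous cocycles along one refinement map are cohomologous. -/
theorem restrictCocycle_congr (ρ : 𝒱.ι → 𝒰.ι) (h : ∀ j, 𝒱.U j ≤ 𝒰.U (ρ j))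
    {t t' : PresheafOfGroups.OneCocycle G 𝒰.U} (ht : t.IsCohomologous t') :
    (restrictCocycle ρ h t).IsCohomologous (restrictCocycle ρ h t') := by
  obtain ⟨b, hb⟩ := ht
  refine ⟨fun i => G.map (homOfLE (h i)).op (b (ρ i)), fun i j T a c => ?_⟩
  have := hb (ρ i) (ρ j) (a ≫ homOfLE (h i)) (c ≫ homOfLE (h j))
  simpa [restrictCocycle] using this

/-- Restrictions of a cocycle along two refinement maps are cohomologous. -/
theorem restrictCocycle_indep (ρ ρ' : 𝒱.ι → 𝒰.ι) (h : ∀ j, 𝒱.U j ≤ 𝒰.U (ρ j))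
    (h' : ∀ j, 𝒱.U j ≤ 𝒰.U (ρ' j)) (t : PresheafOfGroups.OneCocycle G 𝒰.U) :
    (restrictCocycle ρ h t).IsCohomologous (restrictCocycle ρ' h' t) := by
  refine ⟨fun i => t.ev (ρ' i) (ρ i) (homOfLE (h' i)) (homOfLE (h i)), fun i j T a c => ?_⟩
  simp only [restrictCocycle, PresheafOfGroups.OneCochain.ev_precomp]
  rw [t.ev_trans, t.ev_trans]

/-- The map `Ȟ¹(𝒰, G) → Ȟ¹(𝒱, G)` of pointed sets given by restricting cocycles when `𝒱` refines
`𝒰`; it does not depend on the refinement map (see `coverH1Map_class`). -/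
def coverH1Map (G : (Opens X)ᵒᵖ ⥤ GrpCat.{u}) (𝒰 𝒱 : OpenCover X) (h : 𝒰 ≤ 𝒱) :
    OneHom (coverH1 G 𝒰) (coverH1 G 𝒱) where
  toFun := Quot.map (restrictCocycle h.choose h.choose_spec)
    fun _ _ => restrictCocycle_congr h.choose h.choose_spec
  map_one' := rfl

theorem coverH1Map_class (h : 𝒰 ≤ 𝒱) (ρ : 𝒱.ι → 𝒰.ι) (hρ : ∀ j, 𝒱.U j ≤ 𝒰.U (ρ j))
    (t : PresheafOfGroups.OneCocycle G 𝒰.U) :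
    coverH1Map G 𝒰 𝒱 h t.class = (restrictCocycle ρ hρ t).class :=
  (restrictCocycle_indep h.choose ρ h.choose_spec hρ t).class_eq

instance (G : (Opens X)ᵒᵖ ⥤ GrpCat.{u}) :
    DirectedSystem (coverH1 G) (fun _ _ h => coverH1Map G _ _ h) where
  map_self 𝒰 x := by
    obtain ⟨t, rfl⟩ := Quot.exists_rep x
    exact coverH1Map_class le_rfl id (fun _ => le_rfl) t
  map_map 𝒲 𝒱 𝒰 h h' x := by
    obtain ⟨t, rfl⟩ := Quot.exists_rep x
    obtain ⟨ρ, hρ⟩ := id h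
    obtain ⟨σ, hσ⟩ := id h'
    change coverH1Map G _ _ h' (coverH1Map G _ _ h t.class) = coverH1Map G _ _ (h.trans h') t.class
    rw [coverH1Map_class h ρ hρ, coverH1Map_class h' σ hσ,
      coverH1Map_class (h.trans h') (ρ ∘ σ) fun j => (hσ j).trans (hρ (σ j))]
    rfl

end Restriction

/-- The first cohomology set `H¹(X, G)`: the direct limit of `Ȟ¹(𝒰, G)` over all open covers `𝒰`
of `X`, ordered by refinement. -/
def H1 {X : Type u} [TopologicalSpace X] (G : (Opens X)ᵒᵖ ⥤ GrpCat.{u}) : Type (u + 1) :=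
  DirectLimit (coverH1 G) (coverH1Map G)

/-- The distinguished element of `H¹(X, G)`, the class of the identity cocycle of any cover. -/
instance {X : Type u} [TopologicalSpace X] (G : (Opens X)ᵒᵖ ⥤ GrpCat.{u}) : One (H1 G) :=
  inferInstanceAs (One (DirectLimit (coverH1 G) (coverH1Map G)))

/-- The constant sheaf `𝒢ₙ` of sections in the general linear group `GL(n, ℝ)`. -/
abbrev GLSheaf (X : Type u) [TopologicalSpace X] (n : ℕ) : (Opens X)ᵒᵖ ⥤ GrpCat.{u} :=
  constantSheaf X (GL (Fin n) ℝ)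

end CechH1

end

open scoped Manifold ContDiff

namespace CechH1

open CategoryTheory TopologicalSpace Opposite

universe u

/-! A cocycle with values in a discrete group `A` glues the products `U i × A` into a bundle with
fibre `A`, which is a covering space of `X`. As `X` is simply connected and locally path connected,
the identity of `X` lifts to this covering, giving a global section; its coordinates in the local
trivialisations split the cocycle. No refinement is needed: every term of the direct limit is
already trivial. -/

/-- A locally constant cocycle with values in a discrete group, on an open cover of a simply
connected and locally path connected space, is a coboundary. -/
theorem exists_continuousOn_splitting {X : Type*} [TopologicalSpace X] [SimplyConnectedSpace X]
    [LocallyPathConnectedSpace X] {A : Type*} [Group A] [TopologicalSpace A] [DiscreteTopology A]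
    {ι : Type*} (U : ι → Set X) (hU : ∀ i, IsOpen (U i)) (hcover : ∀ x, ∃ i, x ∈ U i)
    (g : ι → ι → X → A) (hg : ∀ i j, ContinuousOn (g i j) (U i ∩ U j))
    (hcocycle : ∀ i j k x, x ∈ U i → x ∈ U j → x ∈ U k → g i j x * g j k x = g i k x) :
    ∃ b : ι → X → A, (∀ i, ContinuousOn (b i) (U i)) ∧
      ∀ i j x, x ∈ U i → x ∈ U j → b i x = g i j x * b j x := by
  choose idx hidx using hcover
  have hself : ∀ i x, x ∈ U i → g i i x = 1 := fun i x hx => by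
    simpa using hcocycle i i i x hx hx hx
  let Z : FiberBundleCore ι X A :=
    { baseSet := U
      isOpen_baseSet := hU
      indexAt := idx
      mem_baseSet_at := hidx
      -- The indices are swapped: passing from chart `i` to chart `j` must turn `b i` into `b j = g
      -- j i * b i`.
      coordChange := fun i j x a => g j i x * a
      coordChange_self := fun i x hx a => by simp [hself i x hx]
      continuousOn_coordChange := fun i j =>
        ((hg j i).comp continuousOn_fst fun p hp => ⟨(Set.mem_prod.1 hp).1.2, (Set.mem_prod.1 hp).1.1⟩).mul continuousOn_snd
      coordChange_comp := fun i j k x hx a => by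
        rw [← mul_assoc, hcocycle k j i x hx.2 hx.1.2 hx.1.1] }
  have hcov : IsCoveringMap Z.proj :=
    IsFiberBundle.isCoveringMap fun x => ⟨Z.localTriv (idx x), hidx x⟩
  obtain ⟨x₀⟩ : Nonempty X := inferInstance
  -- A lift of the identity is a section; the starting value `1` over `x₀` is arbitrary.
  obtain ⟨s, ⟨-, hs⟩, -⟩ := hcov.existsUnique_continuousMap_lifts (ContinuousMap.id X) x₀
    (⟨x₀, (1 : A)⟩ : Z.TotalSpace) rfl
  have hproj : ∀ x, (s x).proj = x := fun x => congrFun hs x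
  refine ⟨fun i x => (Z.localTriv i (s x)).2, fun i => ?_, fun i j x hi hj => ?_⟩
  · refine continuous_snd.comp_continuousOn
      ((Z.localTriv i).continuousOn.comp s.continuous.continuousOn fun x hx => ?_)
    rw [FiberBundleCore.mem_localTriv_source, hproj]
    exact hx
  · simp only [FiberBundleCore.localTriv_apply, hproj, Z]
    let a : A := (s x).snd
    -- A point over `x` is stored by its coordinate `a` in the preferred chart `idx x`.
    change g i (idx x) x * a = g i j x * (g j (idx x) x * a)
    rw [← mul_assoc, hcocycle i j _ x hi hj (hidx x)]

/-- On a simply connected and locally path connected space, every 1-cocycle with values in a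
constant sheaf of groups is cohomologous to the identity cocycle. -/
theorem isCohomologous_one {X : Type u} [TopologicalSpace X] [SimplyConnectedSpace X]
    [LocallyPathConnectedSpace X] {A : Type} [Group A] {𝒰 : OpenCover X}
    (t : PresheafOfGroups.OneCocycle (constantSheaf X A) 𝒰.U) :
    PresheafOfGroups.OneCocycle.IsCohomologous 1 t := by
  classical
  -- With the discrete topology, locally constant means continuous.
  let _ : TopologicalSpace A := ⊥
  have : DiscreteTopology A := ⟨rfl⟩
  let s (i j : 𝒰.ι) : LocallyConstant (𝒰.U i ⊓ 𝒰.U j : Opens X) A :=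
    t.ev i j (homOfLE inf_le_left) (homOfLE inf_le_right)
  -- The value `1` off the overlap is junk: only values on overlaps are used.
  let g (i j : 𝒰.ι) (x : X) : A := if h : x ∈ 𝒰.U i ⊓ 𝒰.U j then s i j ⟨x, h⟩ else 1
  -- Compatibility with restriction determines the cocycle by its values on the full overlaps.
  have hev : ∀ (i j : 𝒰.ι) (T : Opens X) (a : T ⟶ 𝒰.U i) (b : T ⟶ 𝒰.U j) (x : X) (hx : x ∈ T),
      (show LocallyConstant T A from t.ev i j a b) ⟨x, hx⟩ = g i j x := by
    intro i j T a b x hx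
    have hT : x ∈ 𝒰.U i ⊓ 𝒰.U j := ⟨a.le hx, b.le hx⟩
    simp only [g, dif_pos hT]
    have := t.ev_precomp i j (homOfLE (le_inf a.le b.le)) (homOfLE inf_le_left)
      (homOfLE inf_le_right)
    exact (DFunLike.congr_fun (F := LocallyConstant T A) this ⟨x, hx⟩).symm
  obtain ⟨b, hb, hbg⟩ := exists_continuousOn_splitting (fun i => (𝒰.U i : Set X))
    (fun i => (𝒰.U i).isOpen)
    (fun x => by simpa using (𝒰.iSup_eq_top ▸ Opens.mem_top x : x ∈ ⨆ i, 𝒰.U i)) g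
    (fun i j => by
      rw [continuousOn_iff_continuous_domRestrict]
      refine (s i j).continuous.congr fun x => ?_
      have hx : x.1 ∈ 𝒰.U i ⊓ 𝒰.U j := x.2
      change s i j ⟨x.1, hx⟩ = g i j x.1
      simp only [g, dif_pos hx])
    (fun i j k x hi hj hk => by
      let T : Opens X := 𝒰.U i ⊓ 𝒰.U j ⊓ 𝒰.U k
      have hx : x ∈ T := ⟨⟨hi, hj⟩, hk⟩
      let a : T ⟶ 𝒰.U i := homOfLE (inf_le_left.trans inf_le_left)
      let c : T ⟶ 𝒰.U j := homOfLE (inf_le_left.trans inf_le_right)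
      let d : T ⟶ 𝒰.U k := homOfLE inf_le_right
      rw [← hev i j T a c x hx, ← hev j k T c d x hx, ← hev i k T a d x hx]
      exact DFunLike.congr_fun (F := LocallyConstant T A) (t.ev_trans i j k a c d) ⟨x, hx⟩)
  let β (i : 𝒰.ι) : LocallyConstant (𝒰.U i) A :=
    ⟨fun x => b i x, (IsLocallyConstant.iff_continuous _).2
      (continuousOn_iff_continuous_domRestrict.1 (hb i))⟩
  refine ⟨β, fun i j T a c => ?_⟩
  refine LocallyConstant.ext (X := T) (Y := A) fun x => ?_
  change b i x * 1 = (show LocallyConstant T A from t.ev i j a c) x * b j x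
  rw [mul_one, hev i j T a c x x.2]
  exact hbg i j x (a.le x.2) (c.le x.2)

/-- The first cohomology set of a constant sheaf of groups on a simply connected and locally path
connected space consists of the distinguished element. -/
theorem eq_one_of_simplyConnectedSpace {X : Type u} [TopologicalSpace X] [SimplyConnectedSpace X]
    [LocallyPathConnectedSpace X] {A : Type} [Group A] (z : H1 (constantSheaf X A)) : z = 1 := by
  induction z using DirectLimit.induction with
  | _ 𝒰 y =>
    obtain ⟨t, rfl⟩ := Quot.exists_rep y
    rw [show Quot.mk _ t = (1 : coverH1 (constantSheaf X A) 𝒰) from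
      (isCohomologous_one t).class_eq.symm]
    exact (DirectLimit.one_def (f := coverH1Map (constantSheaf X A)) 𝒰).symm

end CechH1

theorem corollary5 (m n : ℕ) (M : Type*) [TopologicalSpace M] [T2Space M]
    [SecondCountableTopology M] [ChartedSpace (EuclideanSpace ℝ (Fin m)) M] [IsManifold (𝓡 m) ∞ M]
    [SimplyConnectedSpace M] :
    (Set.univ : Set (CechH1.H1 (CechH1.GLSheaf M n))) = {1} := by
  have : LocallyPathConnectedSpace M :=
    ChartedSpace.locallyPathConnectedSpace (EuclideanSpace ℝ (Fin m)) M
  exact Set.eq_singleton_iff_unique_mem.2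
    ⟨Set.mem_univ _, fun z _ => CechH1.eq_one_of_simplyConnectedSpace z⟩
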